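/- Let $K$ be a compact Hausdorff space and let $P(K)$ be the set of Radon (regular Borel) probability measures on $K$ with the weak$^*$ topology, in which $\mu_n\to\mu$ iff $\int_K f\,d\mu_n\to\int_K f\,d\mu$ for every continuous $f\colon K\to\mathbb{R}$. Let $S_0(K)\subseteq P(K)$ be the set of finitely supported probability measures, i.e. of convex combinations of finitely many Dirac measures $\delta_x$, $x\in K$. For $0<\alpha\le\omega_1$ let $S_\alpha(K)$ be the set of all weak$^*$ limits in $P(K)$ of sequences $(\mu_n)_{n\in\omega}$ such that each $\mu_n$ belongs to $S_\beta(K)$ for some $\beta<\alpha$, and let $S(K)=S_{\omega_1}(K)$. 1. If $K$ is extremely disconnected (the closure of every open set is open), then every $\mu\in S(K)$ is purely atomic, i.e. $\mu=\sum_{n\in\omega}a_n\delta_{x_n}$ for some points $x_n\in K$ (repetitions allowed) and some positive real numbers $a_n$. 2. Let $K$ be the Stone space of a complete Boolean algebra $\mathbb{B}$, i.e. the space of all ultrafilters on $\mathbb{B}$ with the topology generated by the sets $\{F\in K\colon b\in F\}$, $b\in\mathbb{B}$. If $\mu\in P(K)$ is non-atomic, i.e. for every $\varepsilon>0$ there is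 a finite partition of $K$ into clopen sets of $\mu$-measure less than $\varepsilon$, then $\mu\notin S(K)$. 3. In particular, no non-atomic $\mu\in P(\beta\omega)$ is in $S(\beta\omega)$, where $\beta\omega$ is the Stone–Čech compactification of the discrete space $\omega$; and no non-atomic $\mu\in P(\mathrm{Stone}(\mathfrak{M}))$ is in $S(\mathrm{Stone}(\mathfrak{M}))$, where $\mathfrak{M}$ is the Boolean algebra of Borel subsets of the unit interval modulo Lebesgue null sets. Here non-atomic is defined as in 2. -/

import Mathlib

open MeasureTheory Filter Topology TopologicalSpace
open scoped NNReal ENNReal Ordinal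

namespace SeqMeasure

section Hierarchy

variable {K : Type*} [TopologicalSpace K] [MeasurableSpace K] [BorelSpace K]

/-- `P(K)`: the Radon (regular Borel) probability measures on `K`, with the weak* topology, that is,
the topology of convergence of the integrals of all (bounded) continuous functions. -/
abbrev RadonProb (K : Type*) [TopologicalSpace K] [MeasurableSpace K] [BorelSpace K] : Type _ :=
  {μ : ProbabilityMeasure K // (μ : Measure K).Regular}

/-- `conv (δ_x : x ∈ A)`: the probability measures that are finitely supported on `A`. -/
def finitelySupported (A : Set K) : Set (RadonProb K) :=
  {μ | ∃ (s : Finset K) (a : K → ℝ≥0), (s : Set K) ⊆ A ∧ ∑ x ∈ s, a x = 1 ∧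
    (μ.1 : Measure K) = ∑ x ∈ s, a x • Measure.dirac x}

/-- `S_α(A)`: level `0` consists of the probability measures finitely supported on `A`, and
level `α > 0` of all weak* limits of sequences of measures taken from levels `β < α`. -/
noncomputable def seqLevel (A : Set K) (α : Ordinal.{0}) : Set (RadonProb K) :=
  {μ | (α = 0 ∧ μ ∈ finitelySupported A) ∨
    (α ≠ 0 ∧ ∃ u : ℕ → RadonProb K,
      (∀ n, ∃ (β : Ordinal.{0}) (_ : β < α), u n ∈ seqLevel A β) ∧ Tendsto u atTop (𝓝 μ))}
termination_by α

/-- `S(A) = S_{ω₁}(A)`. -/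
noncomputable def seqClosureOf (A : Set K) : Set (RadonProb K) :=
  seqLevel A (ω_ 1)

/-- `μ = ∑ₙ aₙ δ_{xₙ}` with all `aₙ > 0`. The points `xₙ` may repeat, so that finitely supported
measures are included. -/
def IsPurelyAtomic (μ : RadonProb K) : Prop :=
  ∃ (x : ℕ → K) (a : ℕ → ℝ≥0), (∀ n, 0 < a n) ∧
    (μ.1 : Measure K) = Measure.sum fun n => a n • Measure.dirac (x n)

/-- A set function `m` on a Boolean algebra is non-atomic if there are finite partitions of unity
into elements of arbitrarily small measure. -/
def IsNonatomicOn {B : Type*} [BooleanAlgebra B] (m : B → ℝ≥0) : Prop :=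
  ∀ ε : ℝ≥0, 0 < ε → ∃ P : Finpartition (⊤ : B), ∀ b ∈ P.parts, m b < ε

/-- A measure on a zero-dimensional space is non-atomic if its restriction to the Boolean algebra
of clopen sets is. -/
def IsNonatomic (μ : RadonProb K) : Prop :=
  IsNonatomicOn fun C : Clopens K => μ.1 (C : Set K)

end Hierarchy

section Stone

/-- The Stone space of a Boolean algebra: the set of all its ultrafilters. -/
@[ext]
structure StoneSpace (B : Type*) [BooleanAlgebra B] where
  carrier : Set B
  top_mem : ⊤ ∈ carrier
  bot_notMem : ⊥ ∉ carrier
  inf_mem : ∀ a ∈ carrier, ∀ b ∈ carrier, a ⊓ b ∈ carrier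
  mem_of_le : ∀ a ∈ carrier, ∀ b, a ≤ b → b ∈ carrier
  mem_or_compl_mem : ∀ a, a ∈ carrier ∨ aᶜ ∈ carrier

variable {B : Type*} [BooleanAlgebra B]

/-- The Stone topology, generated by the sets of all ultrafilters containing a given element. -/
instance : TopologicalSpace (StoneSpace B) :=
  generateFrom (Set.range fun b : B => {F : StoneSpace B | b ∈ F.carrier})

instance : MeasurableSpace (StoneSpace B) := borel _

instance : BorelSpace (StoneSpace B) := ⟨rfl⟩

end Stone

section MeasureAlgebra

variable {X : Type*} [MeasurableSpace X]

/-- Equality of measurable sets modulo null sets. -/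
def aeSetoid (μ : Measure X) : Setoid {s : Set X // MeasurableSet s} where
  r s t := s.1 =ᵐ[μ] t.1
  iseqv := ⟨fun _ => ae_eq_refl _, fun h => h.symm, fun h k => h.trans k⟩

/-- The measurable sets modulo null sets. -/
def MeasureAlgebra (μ : Measure X) : Type _ := Quotient (aeSetoid μ)

/-- The Boolean algebra structure: all operations are those of sets, computed on representatives,
and `[s] ≤ [t]` means that `s \ t` is null. -/
noncomputable instance (μ : Measure X) : BooleanAlgebra (MeasureAlgebra μ) where
  le := Quotient.lift₂ (fun s t => s.1 ≤ᵐ[μ] t.1) (fun _ _ _ _ h k =>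
    propext ⟨fun l => h.symm.le.trans (l.trans k.le), fun l => h.le.trans (l.trans k.symm.le)⟩)
  sup := Quotient.map₂ (fun s t => ⟨s.1 ∪ t.1, s.2.union t.2⟩) (fun _ _ h _ _ k => h.union k)
  inf := Quotient.map₂ (fun s t => ⟨s.1 ∩ t.1, s.2.inter t.2⟩) (fun _ _ h _ _ k => h.inter k)
  compl := Quotient.map (fun s => ⟨s.1ᶜ, s.2.compl⟩) (fun _ _ h => h.compl)
  top := Quotient.mk _ ⟨Set.univ, .univ⟩
  bot := Quotient.mk _ ⟨∅, .empty⟩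
  le_refl := by
    rintro ⟨s⟩
    exact EventuallyLE.refl _ _
  le_trans := by
    rintro ⟨s⟩ ⟨t⟩ ⟨r⟩ h k
    exact EventuallyLE.trans h k
  le_antisymm := by
    rintro ⟨s⟩ ⟨t⟩ h k
    exact Quotient.sound (EventuallyLE.antisymm h k)
  le_sup_left := by
    rintro ⟨s⟩ ⟨t⟩
    exact Eventually.of_forall fun x hx => Or.inl hx
  le_sup_right := by
    rintro ⟨s⟩ ⟨t⟩
    exact Eventually.of_forall fun x hx => Or.inr hx
  sup_le := by
    rintro ⟨s⟩ ⟨t⟩ ⟨r⟩ h k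
    filter_upwards [h, k] with x hx kx
    exact fun l => l.elim hx kx
  inf_le_left := by
    rintro ⟨s⟩ ⟨t⟩
    exact Eventually.of_forall fun x hx => hx.1
  inf_le_right := by
    rintro ⟨s⟩ ⟨t⟩
    exact Eventually.of_forall fun x hx => hx.2
  le_inf := by
    rintro ⟨s⟩ ⟨t⟩ ⟨r⟩ h k
    filter_upwards [h, k] with x hx kx
    exact fun l => ⟨hx l, kx l⟩
  le_sup_inf := by
    rintro ⟨s⟩ ⟨t⟩ ⟨r⟩
    refine Eventually.of_forall fun x hx => ?_
    rcases hx with ⟨h1 | h1, h2 | h2⟩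
    · exact Or.inl h1
    · exact Or.inl h1
    · exact Or.inl h2
    · exact Or.inr ⟨h1, h2⟩
  inf_compl_le_bot := by
    rintro ⟨s⟩
    exact Eventually.of_forall fun x hx => hx.2 hx.1
  top_le_sup_compl := by
    rintro ⟨s⟩
    exact Eventually.of_forall fun x _ => Classical.em _
  le_top := by
    rintro ⟨s⟩
    exact Eventually.of_forall fun x _ => trivial
  bot_le := by
    rintro ⟨s⟩
    exact Eventually.of_forall fun x hx => hx.elim

/-- `𝔐`: the Boolean algebra of Borel subsets of the unit interval modulo Lebesgue null sets. -/
abbrev RandomAlgebra : Type := MeasureAlgebra (volume : Measure unitInterval)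

end MeasureAlgebra

end SeqMeasure

/-!
The proof rests on a weak form of the Grothendieck property of `C(K)` for an extremally disconnected
compact space `K`: if `μₙ → μ` weak* and a closed set `C` is `μₙ`-null for all `n`, then it is
`μ`-null (`measure_eq_zero_of_tendsto_of_isClosed`). Otherwise regularity yields a decreasing
sequence of clopen neighbourhoods of `C` along which a fixed amount of mass `δ` of a subsequence
glides: there are disjoint clopen sets `D k` and indices `m k → ∞` such that `μ_{m k} (D k) ≥ δ`.
For every infinite `M ⊆ ℕ`, the closure of `⋃ k ∈ M, D k` is clopen, so `μ` gives it mass at least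
`δ`. Infinitely many disjoint `M` have disjoint closures of this kind, which contradicts finiteness
of `μ` (`not_forall_le_measure_of_pairwise_disjoint`).

If each `μₙ` is carried by a countable set, then `μ` is carried by the union `A` of these sets,
because every compact `C ⊆ Aᶜ` is null for all `μₙ`, hence for `μ`. By induction on the level, all
measures in the hierarchy are carried by countable sets, that is, they are purely atomic. A measure
with an atom does not admit partitions into clopen sets of arbitrarily small measure.

It remains to see that the spaces in question are extremally disconnected. The Stone space of a
Boolean algebra in which all suprema exist is
(`StoneSpace.extremallyDisconnected_of_exists_isLUB`), the algebra of measurable sets modulo null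
sets of a finite measure is such an algebra (`MeasureAlgebra.exists_isLUB`), and the Stone–Čech
compactification of a discrete space is projective.
-/

namespace SeqMeasure

/-! ### Weak* convergent sequences in extremally disconnected spaces -/

section ExtremallyDisconnected

variable {K : Type*} [TopologicalSpace K] [MeasurableSpace K] [BorelSpace K]

lemma tendsto_measure_of_isClopen {ι : Type*} {l : Filter ι} {u : ι → RadonProb K}
    {μ : RadonProb K} (h : Tendsto u l (𝓝 μ)) {E : Set K} (hE : IsClopen E) :
    Tendsto (fun i => ((u i).1 : Measure K) E) l (𝓝 ((μ.1 : Measure K) E)) := by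
  have h1 : Tendsto (fun i => (u i).1) l (𝓝 μ.1) := (continuous_subtype_val.tendsto μ).comp h
  have h2 := ProbabilityMeasure.tendsto_iff_forall_integral_tendsto.1 h1
    (BoundedContinuousFunction.indicator E hE)
  simp only [BoundedContinuousFunction.indicator_apply,
    integral_indicator_one hE.isOpen.measurableSet] at h2
  simpa only [Function.comp_def, measureReal_def,
    ENNReal.ofReal_toReal (measure_ne_top _ E)] using
    (ENNReal.continuous_ofReal.tendsto _).comp h2

/-- A weak* convergent sequence of probability measures has no subsequence whose mass glides along
pairwise disjoint open sets `D k`. Indeed, for every infinite set `M` of indices, the limit has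
mass at least `δ` on the clopen closure of `⋃ k ∈ M, D k`, and for disjoint sets `M` these closures
are disjoint. -/
lemma not_forall_le_measure_of_pairwise_disjoint [ExtremallyDisconnected K]
    {u : ℕ → RadonProb K} {μ : RadonProb K} (h : Tendsto u atTop (𝓝 μ))
    {D : ℕ → Set K} (hD : ∀ k, IsOpen (D k)) (hdisj : Pairwise (Function.onFun Disjoint D))
    {m : ℕ → ℕ} (hm : Tendsto m atTop atTop) {δ : ℝ≥0∞} (hδ : δ ≠ 0) :
    ¬ ∀ k, δ ≤ ((u (m k)).1 : Measure K) (D k) := by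
  intro hle
  let E : ℕ → Set K := fun i => closure (⋃ j, D (Nat.pair i j))
  have hEo : ∀ i, IsOpen (⋃ j, D (Nat.pair i j)) := fun i => isOpen_iUnion fun j => hD _
  have hE : ∀ i, IsClopen (E i) := fun i =>
    ⟨isClosed_closure, ExtremallyDisconnected.open_closure _ (hEo i)⟩
  have hEδ : ∀ i, δ ≤ (μ.1 : Measure K) (E i) := by
    intro i
    have hp : Tendsto (fun j => m (Nat.pair i j)) atTop atTop :=
      hm.comp (tendsto_atTop_mono (fun j => Nat.right_le_pair i j) tendsto_id)
    refine ge_of_tendsto' ((tendsto_measure_of_isClopen h (hE i)).comp hp) fun j => ?_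
    exact (hle _).trans (measure_mono
      ((Set.subset_iUnion (fun j => D (Nat.pair i j)) j).trans subset_closure))
  have hEd : Pairwise (Function.onFun Disjoint E) := by
    intro i i' hne
    refine ExtremallyDisconnected.disjoint_closure_of_disjoint_isOpen ?_ (hEo i) (hEo i')
    refine Set.disjoint_iUnion_left.2 fun j => Set.disjoint_iUnion_right.2 fun j' => hdisj ?_
    exact fun heq => hne (Nat.pair_eq_pair.1 heq).1
  have hsum : ∑' i, (μ.1 : Measure K) (E i) = ⊤ :=
    top_le_iff.1 ((ENNReal.tsum_const_eq_top_of_ne_zero hδ).symm.le.trans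
      (ENNReal.tsum_le_tsum hEδ))
  rw [← measure_iUnion hEd fun i => (hE i).isOpen.measurableSet] at hsum
  exact measure_ne_top _ _ hsum

/-- In an extremally disconnected normal space, closed sets have clopen neighbourhoods that are
arbitrarily small for any given Radon measure. -/
lemma exists_isClopen_superset_measure_lt [NormalSpace K] [ExtremallyDisconnected K]
    (μ : RadonProb K) {C : Set K} (hC : IsClosed C) {r : ℝ≥0∞} (hr : (μ.1 : Measure K) C < r) :
    ∃ V, IsClopen V ∧ C ⊆ V ∧ (μ.1 : Measure K) V < r := by
  have := μ.2
  obtain ⟨U, hCU, hU, hUr⟩ := C.exists_isOpen_lt_of_lt r hr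
  obtain ⟨W, hW, hCW, hWU⟩ := normal_exists_closure_subset hC hU hCU
  exact ⟨closure W, ⟨isClosed_closure, ExtremallyDisconnected.open_closure _ hW⟩,
    hCW.trans subset_closure, (measure_mono hWU).trans_lt hUr⟩

/-- In an extremally disconnected normal space, a closed set that is null for all terms of a weak*
convergent sequence is null for the limit. This is the only consequence of the Grothendieck
property of `C(K)` that is needed. -/
lemma measure_eq_zero_of_tendsto_of_isClosed [NormalSpace K] [ExtremallyDisconnected K]
    {u : ℕ → RadonProb K} {μ : RadonProb K} (h : Tendsto u atTop (𝓝 μ)) {C : Set K}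
    (hC : IsClosed C) (h0 : ∀ n, ((u n).1 : Measure K) C = 0) : (μ.1 : Measure K) C = 0 := by
  by_contra hne
  obtain ⟨δ, hδ0, hδ⟩ : ∃ δ : ℝ≥0∞, δ ≠ 0 ∧ δ + δ < (μ.1 : Measure K) C := by
    obtain ⟨t, ht0, ht⟩ := exists_between (pos_iff_ne_zero.2 hne)
    exact ⟨t / 2, (ENNReal.half_pos ht0.ne').ne', by rwa [ENNReal.add_halves]⟩
  have hV : ∀ n, ∃ V, IsClopen V ∧ C ⊆ V ∧ ((u n).1 : Measure K) V < δ := fun n =>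
    exists_isClopen_superset_measure_lt (u n) hC (by rw [h0 n]; exact pos_iff_ne_zero.2 hδ0)
  choose V hVc hCV hVδ using hV
  -- `W n` is a decreasing sequence of clopen neighbourhoods of `C` with `u i (W n) < δ` for `i < n`.
  let W : ℕ → Set K := fun n => ⋂ i ∈ Finset.range n, V i
  have hWc : ∀ n, IsClopen (W n) := fun n => isClopen_biInter_finset fun i _ => hVc i
  have hCW : ∀ n, C ⊆ W n := fun n => Set.subset_iInter₂ fun i _ => hCV i
  have hWanti : Antitone W := fun a b hab => Set.biInter_subset_biInter_left fun i hi =>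
    Finset.mem_range.2 ((Finset.mem_range.1 hi).trans_le hab)
  have hWδ : ∀ {i n}, i < n → ((u i).1 : Measure K) (W n) < δ := fun {i n} hin =>
    (measure_mono (Set.biInter_subset_of_mem (Finset.mem_range.2 hin))).trans_lt (hVδ i)
  have hg : ∀ n, ∃ N, n ≤ N ∧ δ + δ < ((u N).1 : Measure K) (W n) := fun n =>
    ((eventually_ge_atTop n).and ((tendsto_measure_of_isClopen h (hWc n)).eventually
      (lt_mem_nhds (hδ.trans_le (measure_mono (hCW n)))))).exists
  choose g hgn hgδ using hg
  let a : ℕ → ℕ := fun k => (fun n => g n + 1)^[k] 0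
  have ha : ∀ k, a (k + 1) = g (a k) + 1 := fun k => Function.iterate_succ_apply' _ _ _
  have hlt : ∀ k, g (a k) < a (k + 1) := fun k => by rw [ha]; exact Nat.lt_succ_self _
  have hamono : StrictMono a := strictMono_nat_of_lt_succ fun k => (hgn _).trans_lt (hlt k)
  refine not_forall_le_measure_of_pairwise_disjoint (D := fun k => W (a k) \ W (a (k + 1)))
    (m := fun k => g (a k)) h (fun k => ((hWc _).diff (hWc _)).isOpen) ?_
    (tendsto_atTop_mono (fun k => hamono.le_apply.trans (hgn _)) tendsto_id) hδ0 fun k => ?_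
  · refine (pairwise_disjoint_on _).2 fun i j hij => Set.disjoint_left.2 fun x hi hj => ?_
    exact hi.2 (hWanti (hamono.monotone hij) hj.1)
  · by_contra! hk
    refine (hgδ (a k)).not_ge ?_
    calc ((u (g (a k))).1 : Measure K) (W (a k))
        ≤ ((u (g (a k))).1 : Measure K) ((W (a k) \ W (a (k + 1))) ∪ W (a (k + 1))) :=
          measure_mono (by rw [Set.sdiff_union_self]; exact Set.subset_union_left)
      _ ≤ _ := measure_union_le _ _
      _ ≤ δ + δ := add_le_add hk.le (hWδ (hlt k)).le

/-- A weak* limit of a sequence of measures carried by countable sets is carried by a countable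
set. -/
lemma exists_countable_of_tendsto [NormalSpace K] [T1Space K] [ExtremallyDisconnected K]
    {u : ℕ → RadonProb K} {μ : RadonProb K} (h : Tendsto u atTop (𝓝 μ))
    (hu : ∀ n, ∃ A : Set K, A.Countable ∧ ((u n).1 : Measure K) Aᶜ = 0) :
    ∃ A : Set K, A.Countable ∧ (μ.1 : Measure K) Aᶜ = 0 := by
  choose A hA hA0 using hu
  have hAc : (⋃ n, A n).Countable := Set.countable_iUnion hA
  refine ⟨⋃ n, A n, hAc, ?_⟩
  have := μ.2
  by_contra hne
  obtain ⟨C, hCA, hC, hC0⟩ := hAc.measurableSet.compl.exists_lt_isCompact_of_ne_top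
    (measure_ne_top _ _) (pos_iff_ne_zero.2 hne)
  refine hC0.ne' (measure_eq_zero_of_tendsto_of_isClosed h hC.isClosed fun n => ?_)
  exact measure_mono_null
    (hCA.trans (Set.compl_subset_compl.2 (Set.subset_iUnion A n))) (hA0 n)

lemma exists_countable_of_mem_finitelySupported [T1Space K] {A : Set K} {μ : RadonProb K}
    (hμ : μ ∈ finitelySupported A) :
    ∃ A : Set K, A.Countable ∧ (μ.1 : Measure K) Aᶜ = 0 := by
  obtain ⟨s, a, -, -, h⟩ := hμ
  refine ⟨s, s.countable_toSet, ?_⟩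
  rw [h, Measure.finsetSum_apply]
  refine Finset.sum_eq_zero fun x hx => ?_
  rw [Measure.smul_apply, Measure.dirac_apply' _ s.measurableSet.compl]
  simp [hx]

lemma exists_countable_of_mem_seqLevel [NormalSpace K] [T1Space K] [ExtremallyDisconnected K]
    (A : Set K) (α : Ordinal.{0}) (μ : RadonProb K) (hμ : μ ∈ seqLevel A α) :
    ∃ A : Set K, A.Countable ∧ (μ.1 : Measure K) Aᶜ = 0 := by
  induction α using WellFoundedLT.induction generalizing μ with
  | ind α ih =>
    rw [seqLevel] at hμ
    rcases hμ with ⟨-, hμ⟩ | ⟨-, u, hu, hlim⟩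
    · exact exists_countable_of_mem_finitelySupported hμ
    · refine exists_countable_of_tendsto hlim fun n => ?_
      obtain ⟨β, hβ, hn⟩ := hu n
      exact ih β hβ _ hn

end ExtremallyDisconnected

/-! ### Purely atomic and non-atomic measures -/

section Atomic

variable {K : Type*} [TopologicalSpace K] [MeasurableSpace K] [BorelSpace K]

/-- The mass of each atom is split into infinitely many positive pieces, so that the measure becomes
a sum indexed by `ℕ` even when it has only finitely many atoms. -/
lemma isPurelyAtomic_of_countable [T1Space K] {μ : RadonProb K} {A : Set K} (hA : A.Countable)
    (h0 : (μ.1 : Measure K) Aᶜ = 0) : IsPurelyAtomic μ := by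
  let A' : Set K := {x ∈ A | (μ.1 : Measure K) {x} ≠ 0}
  have hA' : A'.Countable := hA.mono fun x hx => hx.1
  have h0' : (μ.1 : Measure K) A'ᶜ = 0 := by
    have hnull : (μ.1 : Measure K) (⋃ x ∈ A \ A', {x}) = 0 :=
      (measure_biUnion_null_iff (hA.mono Set.sdiff_subset)).2 fun x hx => by
        by_contra hne
        exact hx.2 ⟨hx.1, hne⟩
    refine measure_mono_null (fun x hx => ?_) (measure_union_null h0 hnull)
    by_cases hxA : x ∈ A
    · exact Or.inr (Set.mem_biUnion ⟨hxA, hx⟩ rfl)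
    · exact Or.inl hxA
  have hne : A'.Nonempty := by
    by_contra hemp
    rw [Set.not_nonempty_iff_eq_empty.1 hemp, Set.compl_empty, measure_univ] at h0'
    exact one_ne_zero h0'
  have : Countable A' := hA'.to_subtype
  have : Nonempty A' := hne.to_subtype
  obtain ⟨e⟩ : Nonempty (ℕ ≃ A' × ℕ) := nonempty_equiv_of_countable
  let c : ℕ → ℝ≥0 := fun n => (1 / 2) ^ (n + 1)
  have hc : ∑' n, (c n : ℝ≥0∞) = 1 := by
    simpa [c, ENNReal.inv_pow, ENNReal.coe_inv, ENNReal.inv_mul_cancel] using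
      ENNReal.tsum_geometric_add_one 2⁻¹
  refine ⟨fun n => (e n).1, fun n => μ.1 {((e n).1 : K)} * c (e n).2, fun n => ?_, ?_⟩
  · refine mul_pos (pos_iff_ne_zero.2 fun hzero => (e n).1.2.2 ?_) (by positivity)
    rw [← ProbabilityMeasure.ennreal_coeFn_eq_coeFn_toMeasure, hzero, ENNReal.coe_zero]
  · ext s hs
    have hμs : (μ.1 : Measure K) s = (μ.1 : Measure K) (s ∩ A') :=
      (measure_inter_conull' (by
        exact measure_mono_null (fun x hx => hx.2) h0')).symm
    have hsplit : s ∩ A' = ⋃ x : A', s ∩ {(x : K)} := by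
      rw [← Set.inter_iUnion, Set.iUnion_of_singleton_coe]
    have hsum : (μ.1 : Measure K) (s ∩ A') = ∑' x : A', (μ.1 : Measure K) (s ∩ {(x : K)}) := by
      rw [hsplit]
      refine measure_iUnion (fun x y hxy => ?_) fun x => hs.inter (measurableSet_singleton _)
      refine Set.disjoint_left.2 fun z hz hz' => hxy (Subtype.ext ?_)
      exact hz.2.symm.trans hz'.2
    let f : A' → ℕ → ℝ≥0∞ := fun x k => (μ.1 : Measure K) (s ∩ {(x : K)}) * c k
    have hf : ∀ n, ((μ.1 {((e n).1 : K)} * c (e n).2) • Measure.dirac ((e n).1 : K)) s =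
        f (e n).1 (e n).2 := by
      intro n
      rw [Measure.smul_apply, ENNReal.smul_def, smul_eq_mul, ENNReal.coe_mul,
        ProbabilityMeasure.ennreal_coeFn_eq_coeFn_toMeasure, Measure.dirac_apply' _ hs]
      by_cases hx : ((e n).1 : K) ∈ s
      · simp [f, hx, Set.inter_eq_right.2 (Set.singleton_subset_iff.2 hx)]
      · simp [f, hx, Set.inter_singleton_eq_empty.2 hx]
    rw [hμs, hsum, Measure.sum_apply _ hs, tsum_congr hf,
      e.tsum_eq (fun p : A' × ℕ => f p.1 p.2), ENNReal.tsum_prod]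
    simp only [f, ENNReal.tsum_mul_left, hc, mul_one]

lemma not_isPurelyAtomic_of_isNonatomic {μ : RadonProb K} (hμ : IsNonatomic μ) :
    ¬ IsPurelyAtomic μ := by
  rintro ⟨x, a, ha, h⟩
  obtain ⟨P, hP⟩ := hμ (a 0) (ha 0)
  have hx : ∃ C ∈ P.parts, x 0 ∈ C := by
    have htop : x 0 ∈ P.parts.sup id := by rw [P.sup_parts]; trivial
    rw [← SetLike.mem_coe, Clopens.coe_finset_sup, Set.mem_iUnion₂] at htop
    simpa using htop
  obtain ⟨C, hC, hxC⟩ := hx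
  refine (hP C hC).not_ge ?_
  rw [← ENNReal.coe_le_coe, ProbabilityMeasure.ennreal_coeFn_eq_coeFn_toMeasure, h]
  refine le_trans ?_ (Measure.le_sum (fun n => a n • Measure.dirac (x n)) 0 _)
  rw [Measure.smul_apply, Measure.dirac_apply_of_mem hxC]
  simp [ENNReal.smul_def]

end Atomic

theorem isPurelyAtomic_of_mem_seqClosureOf {K : Type*} [TopologicalSpace K] [CompactSpace K]
    [T2Space K] [ExtremallyDisconnected K] [MeasurableSpace K] [BorelSpace K] {A : Set K}
    {μ : RadonProb K} (hμ : μ ∈ seqClosureOf A) : IsPurelyAtomic μ := by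
  obtain ⟨A, hA, h0⟩ := exists_countable_of_mem_seqLevel _ _ μ hμ
  exact isPurelyAtomic_of_countable hA h0

theorem notMem_seqClosureOf_of_isNonatomic {K : Type*} [TopologicalSpace K] [CompactSpace K]
    [T2Space K] [ExtremallyDisconnected K] [MeasurableSpace K] [BorelSpace K] {A : Set K}
    {μ : RadonProb K} (hμ : IsNonatomic μ) : μ ∉ seqClosureOf A := fun h =>
  not_isPurelyAtomic_of_isNonatomic hμ (isPurelyAtomic_of_mem_seqClosureOf h)


/-! ### Stone spaces of complete Boolean algebras -/

namespace StoneSpace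

variable {B : Type*} [BooleanAlgebra B]

/-- The set of all ultrafilters that contain `b`. -/
def basicOpen (b : B) : Set (StoneSpace B) := {F | b ∈ F.carrier}

lemma mem_basicOpen {b : B} {F : StoneSpace B} : F ∈ basicOpen b ↔ b ∈ F.carrier := Iff.rfl

lemma inf_mem_iff (F : StoneSpace B) {a b : B} :
    a ⊓ b ∈ F.carrier ↔ a ∈ F.carrier ∧ b ∈ F.carrier :=
  ⟨fun h => ⟨F.mem_of_le _ h _ inf_le_left, F.mem_of_le _ h _ inf_le_right⟩,
    fun h => F.inf_mem _ h.1 _ h.2⟩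

lemma compl_mem_iff (F : StoneSpace B) {b : B} : bᶜ ∈ F.carrier ↔ b ∉ F.carrier :=
  ⟨fun h h' => F.bot_notMem (by simpa using F.inf_mem _ h' _ h),
    (F.mem_or_compl_mem b).resolve_left⟩

lemma basicOpen_inf (a b : B) : basicOpen (a ⊓ b) = basicOpen a ∩ basicOpen b :=
  Set.ext fun F => F.inf_mem_iff

lemma basicOpen_compl (b : B) : basicOpen bᶜ = (basicOpen b)ᶜ :=
  Set.ext fun F => F.compl_mem_iff

lemma basicOpen_top : basicOpen (⊤ : B) = Set.univ := Set.eq_univ_of_forall fun F => F.top_mem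

lemma isOpen_basicOpen (b : B) : IsOpen (basicOpen b) := isOpen_generateFrom_of_mem ⟨b, rfl⟩

lemma isClosed_basicOpen (b : B) : IsClosed (basicOpen b) :=
  ⟨by rw [← basicOpen_compl]; exact isOpen_basicOpen _⟩

lemma isTopologicalBasis_basicOpen :
    IsTopologicalBasis (Set.range (basicOpen : B → Set (StoneSpace B))) where
  exists_subset_inter := by
    rintro _ ⟨a, rfl⟩ _ ⟨b, rfl⟩ F hF
    exact ⟨_, ⟨a ⊓ b, rfl⟩, by rwa [basicOpen_inf], (basicOpen_inf a b).le⟩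
  sUnion_eq := Set.eq_univ_of_forall fun F => ⟨_, ⟨⊤, rfl⟩, F.top_mem⟩
  eq_generateFrom := rfl

instance : T2Space (StoneSpace B) where
  t2 F G hne := by
    obtain ⟨b, hb⟩ : ∃ b, ¬ (b ∈ F.carrier ↔ b ∈ G.carrier) := by
      by_contra! h
      exact hne (StoneSpace.ext (Set.ext h))
    by_cases hF : b ∈ F.carrier
    · refine ⟨_, _, isOpen_basicOpen b, isOpen_basicOpen bᶜ, hF, G.compl_mem_iff.2 ?_, ?_⟩
      · exact fun hG => hb (iff_of_true hF hG)
      · rw [basicOpen_compl]; exact disjoint_compl_right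
    · refine ⟨_, _, isOpen_basicOpen bᶜ, isOpen_basicOpen b, F.compl_mem_iff.2 hF, ?_, ?_⟩
      · by_contra hG
        exact hb (iff_of_false hF hG)
      · rw [basicOpen_compl]; exact disjoint_compl_left

/-- The limit of an ultrafilter `𝒰` on the Stone space: it consists of all `b` such that `𝒰`-almost
all points contain `b`. -/
def ultrafilterLim (𝒰 : Ultrafilter (StoneSpace B)) : StoneSpace B where
  carrier := {b | basicOpen b ∈ 𝒰}
  top_mem := by
    change basicOpen (⊤ : B) ∈ 𝒰
    rw [basicOpen_top]; exact univ_mem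
  bot_notMem h := by
    obtain ⟨F, hF⟩ := 𝒰.nonempty_of_mem h
    exact F.bot_notMem hF
  inf_mem a ha b hb := by
    change basicOpen (a ⊓ b) ∈ 𝒰
    rw [basicOpen_inf]; exact inter_mem ha hb
  mem_of_le a ha b hab := mem_of_superset ha fun F hF => F.mem_of_le a hF b hab
  mem_or_compl_mem b := by
    change basicOpen b ∈ 𝒰 ∨ basicOpen bᶜ ∈ 𝒰
    rw [basicOpen_compl]; exact 𝒰.mem_or_compl_mem _

instance : CompactSpace (StoneSpace B) where
  isCompact_univ := isCompact_iff_ultrafilter_le_nhds.2 fun 𝒰 _ => by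
    refine ⟨ultrafilterLim 𝒰, Set.mem_univ _, fun U hU => ?_⟩
    obtain ⟨_, ⟨b, rfl⟩, hb, hbU⟩ := isTopologicalBasis_basicOpen.mem_nhds_iff.1 hU
    exact mem_of_superset (show basicOpen b ∈ 𝒰 from hb) hbU

/-- Every nonzero element of a Boolean algebra belongs to an ultrafilter. -/
lemma basicOpen_nonempty {b : B} (hb : b ≠ ⊥) : (basicOpen b).Nonempty := by
  obtain ⟨J, hJ, -, hbJ⟩ := DistribLattice.prime_ideal_of_disjoint_filter_ideal
    (F := Order.PFilter.principal b) (I := Order.Ideal.principal ⊥) <| by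
      refine Set.disjoint_left.2 fun x hx hx' => hb ?_
      exact le_bot_iff.1 ((Order.PFilter.mem_principal.1 hx).trans
        (Order.Ideal.mem_principal.1 hx'))
  refine ⟨⟨{x | x ∉ J}, ?_, ?_, ?_, ?_, ?_⟩, ?_⟩
  · exact fun h => hJ.toIsProper.ne_univ
      (Set.eq_univ_of_forall fun x => J.lower le_top h)
  · exact fun h => h J.bot_mem
  · exact fun a ha b hb h => (hJ.mem_or_mem h).elim ha hb
  · exact fun a ha b hab h => ha (J.lower hab h)
  · refine fun a => or_iff_not_imp_left.2 fun ha ha' => hJ.toIsProper.ne_univ ?_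
    refine Set.eq_univ_of_forall fun x => J.lower le_top ?_
    rw [← sup_compl_eq_top (x := a)]
    exact J.sup_mem (not_not.1 ha) ha'
  · exact fun h => Set.disjoint_left.1 hbJ (Order.PFilter.mem_principal.2 le_rfl) h

/-- If `B` is complete, the closure of an open set `U` is the basic clopen set of the supremum of all
`b` with `basicOpen b ⊆ U`. -/
lemma extremallyDisconnected_of_exists_isLUB (h : ∀ S : Set B, ∃ s, IsLUB S s) :
    ExtremallyDisconnected (StoneSpace B) where
  open_closure U hU := by
    obtain ⟨s, hs⟩ := h {b | basicOpen b ⊆ U}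
    suffices hcl : closure U = basicOpen s by rw [hcl]; exact isOpen_basicOpen s
    refine (closure_minimal (fun F hF => ?_) (isClosed_basicOpen s)).antisymm fun F hF => ?_
    · obtain ⟨_, ⟨b, rfl⟩, hb, hbU⟩ := isTopologicalBasis_basicOpen.exists_subset_of_mem_open hF hU
      exact F.mem_of_le b hb s (hs.1 hbU)
    · refine isTopologicalBasis_basicOpen.mem_closure_iff.2 ?_
      rintro _ ⟨c, rfl⟩ hc
      have hcs : ∃ b, basicOpen b ⊆ U ∧ c ⊓ b ≠ ⊥ := by
        by_contra! hcb
        have hsc : s ≤ cᶜ := hs.2 fun b hb =>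
          (disjoint_iff.2 (hcb b hb)).symm.le_compl_right
        exact F.compl_mem_iff.1 (F.mem_of_le s hF _ hsc) hc
      obtain ⟨b, hbU, hcb⟩ := hcs
      obtain ⟨G, hG⟩ := basicOpen_nonempty hcb
      rw [basicOpen_inf] at hG
      exact ⟨G, hG.1, hbU hG.2⟩

end StoneSpace

/-! ### Completeness of measure algebras -/

/-- Choose a countable subfamily of `S` whose union has the largest possible measure. By maximality,
this union contains every member of `S` up to a null set. -/
lemma MeasureAlgebra.exists_isLUB {X : Type*} [MeasurableSpace X] (μ : Measure X)
    [IsFiniteMeasure μ] (S : Set (MeasureAlgebra μ)) : ∃ s, IsLUB S s := by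
  let S' : Set {s : Set X // MeasurableSet s} := {s | (Quotient.mk (aeSetoid μ) s) ∈ S}
  let I : Set (Set {s : Set X // MeasurableSet s}) := {C | C.Countable ∧ C ⊆ S'}
  let v : Set {s : Set X // MeasurableSet s} → ℝ≥0∞ := fun C => μ (⋃ s ∈ C, s.1)
  obtain ⟨w, -, hw, hwI⟩ := exists_seq_tendsto_sSup (S := v '' I)
    ⟨_, ∅, ⟨Set.countable_empty, Set.empty_subset _⟩, rfl⟩ (OrderTop.bddAbove _)
  choose C hC hCw using hwI
  let D : Set {s : Set X // MeasurableSet s} := ⋃ n, C n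
  have hD : D ∈ I := ⟨Set.countable_iUnion fun n => (hC n).1, Set.iUnion_subset fun n => (hC n).2⟩
  let T : Set X := ⋃ s ∈ D, s.1
  have hT : MeasurableSet T := MeasurableSet.biUnion hD.1 fun s _ => s.2
  have hmax : sSup (v '' I) ≤ μ T := le_of_tendsto' hw fun n => by
    rw [← hCw n]
    exact measure_mono (Set.biUnion_subset_biUnion_left (Set.subset_iUnion C n))
  refine ⟨Quotient.mk (aeSetoid μ) ⟨T, hT⟩, ?_, ?_⟩
  · rintro ⟨s⟩ hs
    change s.1 ≤ᵐ[μ] T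
    have hI : insert s D ∈ I := ⟨hD.1.insert s, Set.insert_subset hs hD.2⟩
    have hle : μ (T ∪ s.1) ≤ μ T := by
      refine le_trans (le_of_eq ?_) ((le_sSup (Set.mem_image_of_mem v hI)).trans hmax)
      simp only [v, T, Set.biUnion_insert, Set.union_comm]
    have hae : T =ᵐ[μ] (T ∪ s.1 : Set X) :=
      ae_eq_of_subset_of_measure_ge Set.subset_union_left hle hT.nullMeasurableSet
        (measure_ne_top _ _)
    exact (Set.subset_union_right.eventuallyLE).trans hae.symm.le
  · rintro ⟨t⟩ ht
    change T ≤ᵐ[μ] t.1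
    have hall : ∀ s ∈ D, s.1 ≤ᵐ[μ] t.1 := fun s hs => ht (hD.2 hs)
    filter_upwards [(ae_ball_iff hD.1).2 hall] with x hx hxT
    obtain ⟨s, hs, hxs⟩ := Set.mem_iUnion₂.1 hxT
    exact hx s hs hxs

end SeqMeasure

/-! ### Sequential closures contain no non-atomic measures -/

theorem proposition1p2 :
    (∀ (K : Type*) [TopologicalSpace K] [CompactSpace K] [T2Space K] [ExtremallyDisconnected K]
        [MeasurableSpace K] [BorelSpace K] (μ : SeqMeasure.RadonProb K),
        μ ∈ SeqMeasure.seqClosureOf (Set.univ : Set K) → SeqMeasure.IsPurelyAtomic μ) ∧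
    (∀ (B : Type*) [CompleteBooleanAlgebra B]
        (μ : SeqMeasure.RadonProb (SeqMeasure.StoneSpace B)),
        SeqMeasure.IsNonatomic μ →
          μ ∉ SeqMeasure.seqClosureOf (Set.univ : Set (SeqMeasure.StoneSpace B))) ∧
    (∀ [MeasurableSpace (StoneCech ℕ)] [BorelSpace (StoneCech ℕ)]
        (μ : SeqMeasure.RadonProb (StoneCech ℕ)),
        SeqMeasure.IsNonatomic μ →
          μ ∉ SeqMeasure.seqClosureOf (Set.univ : Set (StoneCech ℕ))) ∧
    (∀ μ : SeqMeasure.RadonProb (SeqMeasure.StoneSpace SeqMeasure.RandomAlgebra),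
        SeqMeasure.IsNonatomic μ →
          μ ∉ SeqMeasure.seqClosureOf
            (Set.univ : Set (SeqMeasure.StoneSpace SeqMeasure.RandomAlgebra))) := by
  refine ⟨?_, ?_, ?_, ?_⟩
  · intro K _ _ _ _ _ _ μ hμ
    exact SeqMeasure.isPurelyAtomic_of_mem_seqClosureOf hμ
  · intro B _ μ hμ
    have := SeqMeasure.StoneSpace.extremallyDisconnected_of_exists_isLUB
      fun S : Set B => ⟨sSup S, isLUB_sSup S⟩
    exact SeqMeasure.notMem_seqClosureOf_of_isNonatomic hμ
  · intro _ _ μ hμ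
    have : ExtremallyDisconnected (StoneCech ℕ) :=
      CompactT2.Projective.extremallyDisconnected StoneCech.projective
    exact SeqMeasure.notMem_seqClosureOf_of_isNonatomic hμ
  · intro μ hμ
    have := SeqMeasure.StoneSpace.extremallyDisconnected_of_exists_isLUB
      (SeqMeasure.MeasureAlgebra.exists_isLUB (volume : Measure unitInterval))
    exact SeqMeasure.notMem_seqClosureOf_of_isNonatomic hμ
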